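/- Consider an open network of $J$ infinite server queues. Batches of customers arrive at the points $0 < T_1 < T_2 < \cdots$ of a homogeneous Poisson process on $[0,\infty)$ of rate $\lambda > 0$, and the network is empty before the first arrival. At time $T_i$, for each $j \in \{1,\dots,J\}$, $\Sigma_{ij}$ customers enter at queue $j$, where the vectors $(\Sigma_{i1},\dots,\Sigma_{iJ}) \in \mathbb{Z}_{\geq 0}^J$, $i \geq 1$, are i.i.d. with the law of a random vector $\mathbf{S} = (S_1,\dots,S_J)$. The $\ell$-th customer of batch $i$ that enters at queue $j$ carries a measurable stochastic process $X^j_{i,\ell}$ such that $X^j_{i,\ell}(t) = k$ if it is in queue $k$ at time $T_i + t$ (it takes a further value once the customer has left the network), with $P(X^j_{i,\ell}(t) = k) = q^j_k(t)$ for $t \geq 0$. The arrival process, the batch vectors and the processes $X^j_{i,\ell}$ are mutually independent. Let $\mathbf{N}(t) = (N_1(t),\dots,N_J(t))$, where $N_k(t)$ is the number of customers in queue $k$ at time $t$, and let $Q_j(t) = \sum_{k=1}^J q^j_k(t)$ be the probability that a customer who entered at queue $j$ is still in the network a time $t$ after its arrival. The network is called ergodic if $\mathbf{N}(t)$ converges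 in distribution, as $t \to \infty$, to a proper probability distribution on $\mathbb{Z}_{\geq 0}^J$. Corollary 4.3. Suppose that the occupancy time distributions have exponentially bounded tails, that is, there exist $\delta > 0$ and $t_0 > 0$ such that $Q_j(\tau) \leq e^{-\delta \tau}$ for all $\tau \geq t_0$ and all $j \in \{1,\dots,J\}$. Then the network is ergodic if $\mathbb{E}[\log(S_1 + \cdots + S_J + 1)] < \infty$. -/

import Mathlib

open MeasureTheory ProbabilityTheory Filter Topology
open scoped NNReal ENNReal

/-- The random data of an open network of `J` infinite server queues with batch arrivals, over a
sample space `Ω`; queues are indexed by `Fin J`, batches by `ℕ` and the customers of batch `i` that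
enter at queue `j` by `ℕ`. The probabilistic assumptions are in `IsBatchNetwork`. -/
structure BatchNetwork (Ω : Type*) (J : ℕ) where
  /-- `gap 0` is the time of the first arrival, `gap (i + 1)` the time that elapses between the
  arrivals of batch `i` and batch `i + 1`. -/
  gap : ℕ → Ω → ℝ
  /-- `batch i ω j` customers of batch `i` enter at queue `j`. -/
  batch : ℕ → Ω → Fin J → ℕ
  /-- `mark i j l t ω = some k` if customer `l` among those of batch `i` that enter at queue `j` is
  in queue `k` a time `t` after its arrival, and `none` if it has left the network by then. Only the
  marks with `l < batch i ω j` belong to customers. -/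
  mark : ℕ → Fin J → ℕ → ℝ≥0 → Ω → Option (Fin J)

namespace BatchNetwork

variable {Ω : Type*} {J : ℕ}

/-- The time at which batch `i` arrives. -/
def arrivalTime (D : BatchNetwork Ω J) (i : ℕ) (ω : Ω) : ℝ :=
  ∑ m ∈ Finset.range (i + 1), D.gap m ω

/-- The customers `(i, j, l)` (batch, queue of entry, label) in queue `k` at time `t`. The network
is empty before the first arrival. -/
def customersIn (D : BatchNetwork Ω J) (t : ℝ≥0) (k : Fin J) (ω : Ω) : Set (ℕ × Fin J × ℕ) :=
  {c | D.arrivalTime c.1 ω ≤ t ∧ c.2.2 < D.batch c.1 ω c.2.1 ∧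
    D.mark c.1 c.2.1 c.2.2 (t - D.arrivalTime c.1 ω).toNNReal ω = some k}

/-- `N_k(t)`, the number of customers in queue `k` at time `t`. -/
noncomputable def occupancy (D : BatchNetwork Ω J) (t : ℝ≥0) (k : Fin J) (ω : Ω) : ℕ∞ :=
  (D.customersIn t k ω).encard

/-- The network is ergodic: `(N_1(t), …, N_J(t))` converges in distribution, as `t → ∞`, to a
proper probability distribution on `ℕ^J`. -/
def Ergodic [MeasurableSpace Ω] (D : BatchNetwork Ω J) (P : Measure Ω) : Prop :=
  ∃ π : PMF (Fin J → ℕ), ∀ n : Fin J → ℕ,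
    Tendsto (fun t : ℝ≥0 => P {ω | ∀ k, D.occupancy t k ω = (n k : ℕ∞)}) atTop (𝓝 (π n))

/-- The σ-algebra generated by the whole trajectory of a customer. -/
@[reducible] def markSigma (D : BatchNetwork Ω J) (i : ℕ) (j : Fin J) (l : ℕ) : MeasurableSpace Ω :=
  ⨆ t : ℝ≥0, MeasurableSpace.comap (D.mark i j l t) ⊤

/-- The σ-algebras generated by the individual sources of randomness: the interarrival times, the
batch size vectors and the trajectories of the customers. -/
@[reducible] def sourceSigma (D : BatchNetwork Ω J) : ℕ ⊕ ℕ ⊕ (ℕ × Fin J × ℕ) → MeasurableSpace Ω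
  | .inl i => MeasurableSpace.comap (D.gap i) inferInstance
  | .inr (.inl i) => MeasurableSpace.comap (D.batch i) inferInstance
  | .inr (.inr c) => D.markSigma c.1 c.2.1 c.2.2

end BatchNetwork

/-- The probabilistic assumptions: batches arrive at the points of a homogeneous Poisson process of
rate `rate` (independent exponential interarrival times), their size vectors are independent with
law `batchLaw`, and a customer that entered at queue `j` is, a time `t` later, in queue `k` with
probability `q j k t`; all these random objects are mutually independent. -/
structure IsBatchNetwork {Ω : Type*} [MeasurableSpace Ω] {J : ℕ} (P : Measure Ω) (rate : ℝ)
    (batchLaw : Measure (Fin J → ℕ)) (q : Fin J → Fin J → ℝ≥0 → ℝ) (D : BatchNetwork Ω J) :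
    Prop where
  rate_pos : 0 < rate
  measurable_gap : ∀ i, Measurable (D.gap i)
  gap_law : ∀ i, P.map (D.gap i) = expMeasure rate
  measurable_batch : ∀ i, Measurable (D.batch i)
  batch_law : ∀ i, P.map (D.batch i) = batchLaw
  measurable_mark : ∀ i j l k t, MeasurableSet {ω | D.mark i j l t ω = some k}
  /-- The trajectories are measurable stochastic processes (for instance, right-continuous ones):
  jointly measurable in time and in what the trajectory itself generates. -/
  jointly_measurable_mark : ∀ i j l k,
    MeasurableSet[NNReal.measurableSpace.prod (D.markSigma i j l)] {p : ℝ≥0 × Ω | D.mark i j l p.1 p.2 = some k}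
  mark_law : ∀ i j l k t, P.real {ω | D.mark i j l t ω = some k} = q j k t
  independent : iIndep D.sourceSigma P

/-- `Q_j(t)`, the probability that a customer who entered at queue `j` is still in the network a
time `t` after its arrival. -/
def occupancyTail {J : ℕ} (q : Fin J → Fin J → ℝ≥0 → ℝ) (j : Fin J) (t : ℝ≥0) : ℝ :=
  ∑ k, q j k t

/-- The tails `Q_1, …, Q_J` are exponentially bounded. -/
def ExponentiallyBoundedTails {J : ℕ} (q : Fin J → Fin J → ℝ≥0 → ℝ) : Prop :=
  ∃ δ : ℝ, 0 < δ ∧ ∃ t₀ : ℝ≥0, 0 < t₀ ∧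
    ∀ τ : ℝ≥0, t₀ ≤ τ → ∀ j, occupancyTail q j τ ≤ Real.exp (-δ * τ)

/-! Write λ for the rate, p_t for the law of the queue lengths at time t, r_s for their law a time s
after the first arrival, and β(s) for the probability that a batch of age s still has a customer in
the network. Conditioning on the first arrival gives the renewal equation (`IsBatchNetwork.renewal`)
e^(λt) p_t(A) = 1_A(0) + ∫_0^t λ e^(λs) r_s(A) ds, formally p' = λ(r - p). The later batches form a
network with the same queue length laws (`shift_occupancyLaw_le`), and the first batch matters only
while one of its customers is present, so r_s(A) ≤ p_s(A) + β(s). A Grönwall argument yields p_t'(A)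
≤ p_t(A) + C ∫_t^t' β with C independent of A (`occupancyLaw_le`).

If β is integrable, p_t is therefore Cauchy in total variation and no mass is lost in the limit
(`exists_pmf_tendsto_of_forall_le_add`). For a batch of total size S, a union bound gives β(s) ≤ E
min(1, S e^(-δs)) at large ages, and the integral over s of min(1, e^(Y-δs)) with Y = log(S + 1) is
at most (Y + 1)/δ. This is where the logarithmic moment enters
(`lintegral_map_batchOccupancy_ne_top`).

The Grönwall bound, the equality of laws and the almost sure finiteness share one mechanism: a
trivial bound by 1 is fed repeatedly into the renewal equation, which multiplies the error by a
factor 1 - e^(-λ·length) < 1 each time. -/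

/-! ### Integrating out an independent variable -/

/-- Freezing lemma: of two independent random variables, the first can be integrated out
separately in an event that depends on both. -/
theorem measure_setOf_eq_lintegral_of_indepFun {Ω E F : Type*} [MeasurableSpace E]
    [MeasurableSpace F] [MeasurableSpace Ω] {P : Measure Ω} [IsProbabilityMeasure P] {X : Ω → E}
    {Y : Ω → F} (hX : Measurable X) (hY : Measurable Y) (hind : IndepFun X Y P)
    {S : Set (E × F)} (hS : MeasurableSet S) :
    P {ω | (X ω, Y ω) ∈ S} = ∫⁻ u, P {ω | (u, Y ω) ∈ S} ∂(P.map X) := by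
  have : IsProbabilityMeasure (P.map Y) := Measure.isProbabilityMeasure_map hY.aemeasurable
  have h1 : P {ω | (X ω, Y ω) ∈ S} = P.map (fun ω => (X ω, Y ω)) S :=
    (Measure.map_apply (hX.prodMk hY) hS).symm
  rw [h1, (indepFun_iff_map_prod_eq_prod_map_map hX.aemeasurable hY.aemeasurable).1 hind,
    Measure.prod_apply hS]
  refine lintegral_congr fun u => ?_
  rw [Measure.map_apply hY (measurable_prodMk_left hS)]
  rfl

/-- Freezing lemma for a random variable `X` that is independent of a σ-algebra `m`. -/
theorem measure_setOf_eq_lintegral_of_indep {Ω E : Type*} [MeasurableSpace E]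
    {m mΩ : MeasurableSpace Ω} {P : Measure Ω} [IsProbabilityMeasure P] (hm : m ≤ mΩ) {X : Ω → E}
    (hX : Measurable X) (hind : Indep (MeasurableSpace.comap X inferInstance) m P)
    {S : Set (E × Ω)} (hS : MeasurableSet[MeasurableSpace.prod inferInstance m] S) :
    P {ω | (X ω, ω) ∈ S} = ∫⁻ u, P {ω | (u, ω) ∈ S} ∂(P.map X) := by
  refine @measure_setOf_eq_lintegral_of_indepFun Ω E Ω _ m mΩ P _ X id hX (measurable_id'' hm)
    ((@IndepFun_iff_Indep Ω E Ω mΩ _ m X id P).2 ?_) S hS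
  rw [MeasurableSpace.comap_id]
  exact hind

/-! ### Sources of randomness and measurability -/

namespace BatchNetwork

variable {Ω : Type*} {J : ℕ}

/-- The numbers of customers of batch `i` in the several queues, a time `s` after its arrival. -/
noncomputable def batchOccupancy (D : BatchNetwork Ω J) (i : ℕ) (s : ℝ≥0) (ω : Ω) : Fin J → ℕ∞ :=
  fun k => {c : Fin J × ℕ | c.2 < D.batch i ω c.1 ∧ D.mark i c.1 c.2 s ω = some k}.encard

/-- The network whose batches are those of `D` but the first one, and whose clock starts with the
arrival of the first one. -/
def shift (D : BatchNetwork Ω J) : BatchNetwork Ω J where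
  gap i := D.gap (i + 1)
  batch i := D.batch (i + 1)
  mark i := D.mark (i + 1)

/-- The source of randomness of `D` that is the given source of `D.shift`. -/
def shiftIndex : ℕ ⊕ ℕ ⊕ (ℕ × Fin J × ℕ) → ℕ ⊕ ℕ ⊕ (ℕ × Fin J × ℕ)
  | .inl i => .inl (i + 1)
  | .inr (.inl i) => .inr (.inl (i + 1))
  | .inr (.inr c) => .inr (.inr (c.1 + 1, c.2))

theorem shiftIndex_injective : Function.Injective (shiftIndex (J := J)) := by
  rintro (i | i | ⟨i, j, l⟩) (i' | i' | ⟨i', j', l'⟩) h <;> simp_all [shiftIndex]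

theorem sourceSigma_shift (D : BatchNetwork Ω J) (x : ℕ ⊕ ℕ ⊕ (ℕ × Fin J × ℕ)) :
    D.shift.sourceSigma x = D.sourceSigma (shiftIndex x) := by
  rcases x with i | i | c <;> rfl

/-- The sources of randomness of batch `i`: its size vector and the trajectories of its
customers. -/
def batchSources (J : ℕ) (i : ℕ) : Set (ℕ ⊕ ℕ ⊕ (ℕ × Fin J × ℕ)) :=
  {x | x = .inr (.inl i) ∨ ∃ c, x = .inr (.inr (i, c))}

/-- Joint measurability in time permits evaluating a trajectory at a random age. The σ-algebra `m`
stays free because the independence arguments need measurability with respect to selected sources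
only. -/
theorem measurable_mark_comp {m : MeasurableSpace Ω} {D : BatchNetwork Ω J} {i : ℕ} {j : Fin J}
    {l : ℕ} {k : Fin J} (hle : D.markSigma i j l ≤ m)
    (hmark : MeasurableSet[NNReal.measurableSpace.prod (D.markSigma i j l)]
      {p : ℝ≥0 × Ω | D.mark i j l p.1 p.2 = some k})
    {τ : ℝ≥0 × Ω → ℝ≥0} (hτ : Measurable τ) :
    MeasurableSet {p : ℝ≥0 × Ω | D.mark i j l (τ p) p.2 = some k} := by
  have h : Measurable[NNReal.measurableSpace.prod m, NNReal.measurableSpace.prod (D.markSigma i j l)]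
      fun p : ℝ≥0 × Ω => (τ p, p.2) :=
    @Measurable.prodMk _ (NNReal.measurableSpace.prod m) _ _ _ (D.markSigma i j l) _ _ hτ
      (@Measurable.mono _ _ (NNReal.measurableSpace.prod m) (NNReal.measurableSpace.prod m) m
        (D.markSigma i j l) _ measurable_snd le_rfl hle)
  exact h hmark

theorem measurable_batchOccupancy {m : MeasurableSpace Ω} {D : BatchNetwork Ω J} {i : ℕ}
    (hle : ∀ x ∈ batchSources J i, D.sourceSigma x ≤ m)
    (hmark : ∀ j l k, MeasurableSet[NNReal.measurableSpace.prod (D.markSigma i j l)]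
      {p : ℝ≥0 × Ω | D.mark i j l p.1 p.2 = some k}) :
    Measurable fun p : ℝ≥0 × Ω => D.batchOccupancy i p.1 p.2 := by
  refine measurable_pi_lambda _ fun k => measurable_encard.comp (measurable_set_iff.2 fun c => ?_)
  refine measurableSet_setOfPred.1 (MeasurableSet.inter ?_ ?_)
  · have hb : Measurable[m] (D.batch i) :=
      Measurable.mono (comap_measurable _) (hle (.inr (.inl i)) (Or.inl rfl)) le_rfl
    exact measurableSet_lt measurable_const
      ((measurable_pi_apply c.1).comp (hb.comp measurable_snd))
  · exact measurable_mark_comp (hle (.inr (.inr (i, c))) (Or.inr ⟨c, rfl⟩)) (hmark c.1 c.2 k)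
      measurable_fst

theorem measurable_arrivalTime {m : MeasurableSpace Ω} {D : BatchNetwork Ω J}
    (hle : ∀ i, MeasurableSpace.comap (D.gap i) inferInstance ≤ m) (i : ℕ) :
    Measurable (D.arrivalTime i) :=
  Finset.measurable_fun_sum _ fun n _ => Measurable.mono (comap_measurable _) (hle n) le_rfl

theorem measurable_occupancy {m : MeasurableSpace Ω} {D : BatchNetwork Ω J}
    (hle : ∀ x, D.sourceSigma x ≤ m)
    (hmark : ∀ i j l k, MeasurableSet[NNReal.measurableSpace.prod (D.markSigma i j l)]
      {p : ℝ≥0 × Ω | D.mark i j l p.1 p.2 = some k}) :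
    Measurable fun p : ℝ≥0 × Ω => fun k => D.occupancy p.1 k p.2 := by
  refine measurable_pi_lambda _ fun k => measurable_encard.comp (measurable_set_iff.2 fun c => ?_)
  have hT : Measurable fun p : ℝ≥0 × Ω => D.arrivalTime c.1 p.2 :=
    (measurable_arrivalTime (fun i => hle (.inl i)) c.1).comp measurable_snd
  have ht : Measurable fun p : ℝ≥0 × Ω => (p.1 : ℝ) := measurable_fst.coe_nnreal_real
  have hb : Measurable[m] (D.batch c.1) :=
    Measurable.mono (comap_measurable _) (hle (.inr (.inl c.1))) le_rfl
  refine measurableSet_setOfPred.1 (MeasurableSet.inter (measurableSet_le hT ht)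
    (MeasurableSet.inter ?_ ?_))
  · exact measurableSet_lt measurable_const
      ((measurable_pi_apply c.2.1).comp (hb.comp measurable_snd))
  · exact measurable_mark_comp (hle (.inr (.inr c))) (hmark c.1 c.2.1 c.2.2 k)
      (ht.sub hT).real_toNNReal

end BatchNetwork

/-! ### Decomposition at the first arrival -/

namespace BatchNetwork

variable {Ω : Type*} {J : ℕ}

theorem arrivalTime_succ (D : BatchNetwork Ω J) (i : ℕ) (ω : Ω) :
    D.arrivalTime (i + 1) ω = D.gap 0 ω + D.shift.arrivalTime i ω := by
  simp only [arrivalTime, shift]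
  rw [Finset.sum_range_succ' _ (i + 1), add_comm]

theorem batchOccupancy_ne_top (D : BatchNetwork Ω J) (i : ℕ) (s : ℝ≥0) (ω : Ω) (k : Fin J) :
    D.batchOccupancy i s ω k ≠ ⊤ := by
  refine Set.encard_ne_top_iff.2 (Set.Finite.subset
    (Set.finite_iUnion fun j => (Set.finite_lt_nat (D.batch i ω j)).image (Prod.mk j)) ?_)
  rintro ⟨j, l⟩ ⟨h, -⟩
  exact Set.mem_iUnion.2 ⟨j, l, h, rfl⟩

theorem occupancy_eq_zero_of_lt_gap {D : BatchNetwork Ω J} {t : ℝ≥0} {ω : Ω}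
    (h : ∀ i, 0 ≤ D.gap i ω) (ht : t < D.gap 0 ω) (k : Fin J) : D.occupancy t k ω = 0 := by
  rw [occupancy, Set.encard_eq_zero, Set.eq_empty_iff_forall_notMem]
  rintro c ⟨hc, -⟩
  refine absurd (ht.trans_le (le_trans ?_ hc)) (lt_irrefl _)
  exact Finset.single_le_sum (f := fun m => D.gap m ω) (fun i _ => h i)
    (Finset.mem_range.2 (Nat.succ_pos _))

/-- The time elapsed since the first arrival is both the age of the first batch and the clock of the
shifted network. -/
theorem occupancy_eq_add_of_gap_le {D : BatchNetwork Ω J} {t : ℝ≥0} {ω : Ω}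
    (ht : D.gap 0 ω ≤ t) (k : Fin J) :
    D.occupancy t k ω = D.batchOccupancy 0 (t - D.gap 0 ω).toNNReal ω k +
      D.shift.occupancy (t - D.gap 0 ω).toNNReal k ω := by
  have hr : ((t - D.gap 0 ω).toNNReal : ℝ) = t - D.gap 0 ω := Real.coe_toNNReal _ (by linarith)
  have h0 : D.arrivalTime 0 ω = D.gap 0 ω := by simp [arrivalTime]
  have hinj : Function.Injective fun c : ℕ × Fin J × ℕ => (c.1 + 1, c.2) := by
    rintro ⟨i, j, l⟩ ⟨i', j', l'⟩ h
    simpa using h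
  have hset : D.customersIn t k ω =
      (fun c : Fin J × ℕ => (0, c)) '' {c | c.2 < D.batch 0 ω c.1 ∧
        D.mark 0 c.1 c.2 (t - D.gap 0 ω).toNNReal ω = some k} ∪
      (fun c : ℕ × Fin J × ℕ => (c.1 + 1, c.2)) ''
        D.shift.customersIn (t - D.gap 0 ω).toNNReal k ω := by
    ext ⟨i, j, l⟩
    rcases i with _ | i
    · simp [customersIn, h0, ht]
    · have h1 : D.arrivalTime (i + 1) ω ≤ t ↔ D.shift.arrivalTime i ω ≤ t - D.gap 0 ω := by
        rw [arrivalTime_succ, le_sub_iff_add_le']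
      have h2 : (t : ℝ) - D.arrivalTime (i + 1) ω = t - D.gap 0 ω - D.shift.arrivalTime i ω := by
        rw [arrivalTime_succ]; ring
      simp only [customersIn, hr, Set.mem_union, Set.mem_image, Set.mem_ofPred_eq, Prod.mk.injEq,
        h1, h2]
      constructor
      · intro h
        exact Or.inr ⟨(i, j, l), h, rfl, rfl⟩
      · rintro (⟨c, -, h, -⟩ | ⟨⟨i', c⟩, h, hi, rfl⟩)
        · exact absurd h (by simp)
        · obtain rfl : i' = i := by simpa using hi
          exact h
  rw [occupancy, hset, Set.encard_union_eq, hinj.encard_image,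
    (Prod.mk_right_injective 0).encard_image]
  · rfl
  · rw [Set.disjoint_left]
    rintro _ ⟨c, -, rfl⟩ ⟨c', -, h⟩
    simp at h

/-- The first gap is replaced by a free real variable, so that `m` need not contain it; this is the
form the freezing lemma requires. -/
theorem measurableSet_firstArrival {m : MeasurableSpace Ω} {D : BatchNetwork Ω J} {t : ℝ}
    {A : Set (Fin J → ℕ∞)} (hle : ∀ x ∈ batchSources J 0, D.sourceSigma x ≤ m)
    (hle' : ∀ x, D.shift.sourceSigma x ≤ m)
    (hmark : ∀ i j l k, MeasurableSet[NNReal.measurableSpace.prod (D.markSigma i j l)]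
      {p : ℝ≥0 × Ω | D.mark i j l p.1 p.2 = some k}) :
    MeasurableSet {p : ℝ × Ω | if p.1 ≤ t then D.batchOccupancy 0 (t - p.1).toNNReal p.2 +
      (fun k => D.shift.occupancy (t - p.1).toNNReal k p.2) ∈ A else 0 ∈ A} := by
  have h : Measurable fun p : ℝ≥0 × Ω =>
      D.batchOccupancy 0 p.1 p.2 + fun k => D.shift.occupancy p.1 k p.2 :=
    (measurable_of_countable fun p : (Fin J → ℕ∞) × (Fin J → ℕ∞) => p.1 + p.2).comp
      ((measurable_batchOccupancy hle (hmark 0)).prodMk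
        (measurable_occupancy hle' fun i => hmark (i + 1)))
  have hτ : Measurable fun p : ℝ × Ω => ((t - p.1).toNNReal, p.2) :=
    (measurable_const.sub measurable_fst).real_toNNReal.prodMk measurable_snd
  have hp : MeasurableSet {p : ℝ × Ω | p.1 ≤ t} := measurableSet_le measurable_fst measurable_const
  convert! hp.ite ((h.comp hτ) (MeasurableSet.of_discrete (s := A))) (MeasurableSet.const (0 ∈ A))
    using 1
  ext p
  by_cases hpt : p.1 ≤ t <;> simp [Set.ite, hpt]

/-- The joint law of the numbers of customers in the queues at time `t`. -/
noncomputable def occupancyLaw [MeasurableSpace Ω] (D : BatchNetwork Ω J) (P : Measure Ω)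
    (t : ℝ≥0) : Measure (Fin J → ℕ∞) :=
  P.map fun ω k => D.occupancy t k ω

/-- The law of the numbers of customers a time `s` after the first arrival. -/
noncomputable def postArrivalLaw [MeasurableSpace Ω] (D : BatchNetwork Ω J) (P : Measure Ω)
    (s : ℝ≥0) : Measure (Fin J → ℕ∞) :=
  P.map fun ω => D.batchOccupancy 0 s ω + fun k => D.shift.occupancy s k ω

end BatchNetwork

namespace IsBatchNetwork

open BatchNetwork

variable {Ω : Type*} [MeasurableSpace Ω] {J : ℕ} {P : Measure Ω} {rate : ℝ}
  {batchLaw : Measure (Fin J → ℕ)} {q : Fin J → Fin J → ℝ≥0 → ℝ} {D : BatchNetwork Ω J}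

theorem measurableSet_mark_eq (hD : IsBatchNetwork P rate batchLaw q D) (i : ℕ) (j : Fin J) (l : ℕ)
    (t : ℝ≥0) (o : Option (Fin J)) : MeasurableSet (D.mark i j l t ⁻¹' {o}) := by
  rcases o with _ | k
  · have : D.mark i j l t ⁻¹' {none} = (⋃ k, {ω | D.mark i j l t ω = some k})ᶜ := by
      ext ω
      rcases h : D.mark i j l t ω <;> simp [h]
    rw [this]
    exact (MeasurableSet.iUnion fun k => hD.measurable_mark i j l k t).compl
  · exact hD.measurable_mark i j l k t

theorem sourceSigma_le (hD : IsBatchNetwork P rate batchLaw q D)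
    (x : ℕ ⊕ ℕ ⊕ (ℕ × Fin J × ℕ)) : D.sourceSigma x ≤ ‹MeasurableSpace Ω› := by
  rcases x with i | i | c
  · exact (hD.measurable_gap i).comap_le
  · exact (hD.measurable_batch i).comap_le
  · refine iSup_le fun t => Measurable.comap_le ?_
    let _ : MeasurableSpace (Option (Fin J)) := ⊤
    exact measurable_to_countable' fun o => hD.measurableSet_mark_eq _ _ _ _ o

theorem shift (hD : IsBatchNetwork P rate batchLaw q D) :
    IsBatchNetwork P rate batchLaw q D.shift where
  rate_pos := hD.rate_pos
  measurable_gap i := hD.measurable_gap (i + 1)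
  gap_law i := hD.gap_law (i + 1)
  measurable_batch i := hD.measurable_batch (i + 1)
  batch_law i := hD.batch_law (i + 1)
  measurable_mark i := hD.measurable_mark (i + 1)
  jointly_measurable_mark i := hD.jointly_measurable_mark (i + 1)
  mark_law i := hD.mark_law (i + 1)
  independent := by
    have h : D.shift.sourceSigma = D.sourceSigma ∘ shiftIndex := funext fun x =>
      sourceSigma_shift D x
    rw [h]
    exact hD.independent.precomp shiftIndex_injective

theorem measurable_occupancy_apply (hD : IsBatchNetwork P rate batchLaw q D) (t : ℝ≥0) :
    Measurable fun ω k => D.occupancy t k ω :=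
  Measurable.comp (g := fun p : ℝ≥0 × Ω => fun k => D.occupancy p.1 k p.2) (f := Prod.mk t)
    (measurable_occupancy hD.sourceSigma_le hD.jointly_measurable_mark) measurable_prodMk_left

theorem measurable_batchOccupancy_apply (hD : IsBatchNetwork P rate batchLaw q D) (i : ℕ)
    (s : ℝ≥0) : Measurable (D.batchOccupancy i s) :=
  Measurable.comp (g := fun p : ℝ≥0 × Ω => D.batchOccupancy i p.1 p.2) (f := Prod.mk s)
    (measurable_batchOccupancy (fun x _ => hD.sourceSigma_le x) (hD.jointly_measurable_mark i))
    measurable_prodMk_left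

theorem measurable_postArrival (hD : IsBatchNetwork P rate batchLaw q D) (s : ℝ≥0) :
    Measurable fun ω => (D.batchOccupancy 0 s ω, fun k => D.shift.occupancy s k ω) :=
  (hD.measurable_batchOccupancy_apply 0 s).prodMk (hD.shift.measurable_occupancy_apply s)

theorem measurable_postArrival_add (hD : IsBatchNetwork P rate batchLaw q D) (s : ℝ≥0) :
    Measurable fun ω => D.batchOccupancy 0 s ω + fun k => D.shift.occupancy s k ω :=
  (measurable_of_countable fun p : (Fin J → ℕ∞) × (Fin J → ℕ∞) => p.1 + p.2).comp
    (hD.measurable_postArrival s)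

theorem isProbabilityMeasure_occupancyLaw [IsProbabilityMeasure P]
    (hD : IsBatchNetwork P rate batchLaw q D) (t : ℝ≥0) :
    IsProbabilityMeasure (D.occupancyLaw P t) :=
  Measure.isProbabilityMeasure_map (hD.measurable_occupancy_apply t).aemeasurable

theorem ae_gap_nonneg (hD : IsBatchNetwork P rate batchLaw q D) : ∀ᵐ ω ∂P, ∀ i, 0 ≤ D.gap i ω := by
  refine ae_all_iff.2 fun i => ?_
  refine ae_of_ae_map (hD.measurable_gap i).aemeasurable (p := fun x => 0 ≤ x) ?_
  rw [hD.gap_law i, ae_iff]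
  simp only [not_le]
  change expMeasure rate (Set.Iio 0) = 0
  change (volume.withDensity (exponentialPDF rate)) (Set.Iio 0) = 0
  rw [withDensity_apply _ measurableSet_Iio]
  exact lintegral_exponentialPDF_of_nonpos le_rfl

end IsBatchNetwork

/-! ### Exponential weights and the renewal equation -/

theorem expMeasure_Ioi {r : ℝ} (hr : 0 < r) {x : ℝ} (hx : 0 ≤ x) :
    expMeasure r (Set.Ioi x) = ENNReal.ofReal (Real.exp (-(r * x))) := by
  have := isProbabilityMeasure_expMeasure hr
  have h : (expMeasure r).real (Set.Iic x) = 1 - Real.exp (-(r * x)) := by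
    rw [← cdf_eq_real, cdf_expMeasure_eq hr, if_pos hx]
  rw [← Set.compl_Iic, ← ofReal_measureReal, probReal_compl_eq_one_sub measurableSet_Iic, h]
  congr 1
  ring

/-- Integration against an exponential law of a function of the residual time. -/
theorem setLIntegral_Iic_expMeasure_sub {r : ℝ} {t : ℝ} {f : ℝ → ℝ≥0∞} (hf : Measurable f) :
    ENNReal.ofReal (Real.exp (r * t)) * ∫⁻ u in Set.Iic t, f (t - u) ∂(expMeasure r) =
      ∫⁻ s in Set.Icc 0 t, ENNReal.ofReal (r * Real.exp (r * s)) * f s := by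
  have hm : Measurable fun u => f (t - u) := hf.comp (measurable_const.sub measurable_id)
  have h1 : ∫⁻ u in Set.Iic t, f (t - u) ∂(expMeasure r) =
      ∫⁻ u, (Set.Ici 0).indicator (fun s => exponentialPDF r (t - s) * f s) (t - u) := by
    have hpdf : Measurable (exponentialPDF r) := (measurable_exponentialPDFReal r).ennreal_ofReal
    change ∫⁻ u in Set.Iic t, f (t - u) ∂(volume.withDensity (exponentialPDF r)) = _
    rw [setLIntegral_withDensity_eq_setLIntegral_mul _ hpdf hm measurableSet_Iic,
      ← lintegral_indicator measurableSet_Iic]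
    refine lintegral_congr fun u => ?_
    by_cases hu : u ≤ t <;> simp [Set.indicator, hu]
  -- Reflection `u ↦ t - u`; the factor `exp (r * t)` then turns the density at `t - s` into `r *
  -- exp (r * s)`, free of `t`.
  rw [h1, lintegral_sub_left_eq_self (fun u => (Set.Ici 0).indicator
    (fun s => exponentialPDF r (t - s) * f s) u) t, ← lintegral_const_mul',
    ← lintegral_indicator measurableSet_Icc]
  · refine lintegral_congr fun s => ?_
    by_cases h0 : 0 ≤ s
    · by_cases hst : s ≤ t
      · rw [Set.indicator_of_mem (Set.mem_Ici.2 h0), Set.indicator_of_mem (Set.mem_Icc.2 ⟨h0, hst⟩),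
          exponentialPDF_of_nonneg (sub_nonneg.2 hst), ← mul_assoc,
          ← ENNReal.ofReal_mul (Real.exp_pos _).le]
        congr 2
        rw [mul_left_comm, ← Real.exp_add]
        congr 2
        ring
      · rw [Set.indicator_of_mem (Set.mem_Ici.2 h0), Set.indicator_of_notMem (by simp [hst]),
          exponentialPDF_of_neg (by linarith), zero_mul, mul_zero]
    · simp [Set.indicator, h0]
  · exact ENNReal.ofReal_ne_top

namespace IsBatchNetwork

open BatchNetwork

variable {Ω : Type*} [MeasurableSpace Ω] {J : ℕ} {P : Measure Ω} {rate : ℝ}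
  {batchLaw : Measure (Fin J → ℕ)} {q : Fin J → Fin J → ℝ≥0 → ℝ} {D : BatchNetwork Ω J}

theorem measurable_postArrivalLaw [IsProbabilityMeasure P]
    (hD : IsBatchNetwork P rate batchLaw q D) (A : Set (Fin J → ℕ∞)) :
    Measurable fun s : ℝ => D.postArrivalLaw P s.toNNReal A := by
  have h : Measurable fun p : ℝ≥0 × Ω =>
      D.batchOccupancy 0 p.1 p.2 + fun k => D.shift.occupancy p.1 k p.2 :=
    (measurable_of_countable fun p : (Fin J → ℕ∞) × (Fin J → ℕ∞) => p.1 + p.2).comp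
      ((measurable_batchOccupancy (fun x _ => hD.sourceSigma_le x)
        (hD.jointly_measurable_mark 0)).prodMk
        (measurable_occupancy hD.shift.sourceSigma_le hD.shift.jointly_measurable_mark))
  have h' := measurable_measure_prodMk_left (ν := P) (h (MeasurableSet.of_discrete (s := A)))
  convert h'.comp measurable_real_toNNReal using 2 with s
  rw [postArrivalLaw, Measure.map_apply (hD.measurable_postArrival_add _) MeasurableSet.of_discrete]
  rfl

theorem occupancyLaw_eq_lintegral [IsProbabilityMeasure P]
    (hD : IsBatchNetwork P rate batchLaw q D) (t : ℝ≥0) (A : Set (Fin J → ℕ∞)) :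
    D.occupancyLaw P t A = ∫⁻ u, (if u ≤ t then D.postArrivalLaw P (t - u).toNNReal A
      else A.indicator 1 0) ∂(expMeasure rate) := by
  -- All sources except the first gap: they determine the evolution after the first arrival and are
  -- independent of its time.
  set T : Set (ℕ ⊕ ℕ ⊕ (ℕ × Fin J × ℕ)) := {.inl 0}ᶜ with hT
  have hmle : (⨆ x ∈ T, D.sourceSigma x) ≤ ‹MeasurableSpace Ω› := iSup₂_le fun x _ => hD.sourceSigma_le x
  have hTm : ∀ x ∈ T, D.sourceSigma x ≤ ⨆ x ∈ T, D.sourceSigma x :=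
    fun x hx => le_iSup₂_of_le x hx le_rfl
  have hind : Indep (MeasurableSpace.comap (D.gap 0) inferInstance)
      (⨆ x ∈ T, D.sourceSigma x) P := by
    have h := indep_iSup_of_disjoint hD.sourceSigma_le hD.independent
      (S := {.inl 0}) (T := T) disjoint_compl_right
    simpa only [Set.mem_singleton_iff, iSup_iSup_eq_left] using h
  set S : Set (ℝ × Ω) := {p | if p.1 ≤ t then D.batchOccupancy 0 (t - p.1).toNNReal p.2 +
    (fun k => D.shift.occupancy (t - p.1).toNNReal k p.2) ∈ A else 0 ∈ A} with hS
  have hSm : MeasurableSet[MeasurableSpace.prod inferInstance (⨆ x ∈ T, D.sourceSigma x)] S :=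
    measurableSet_firstArrival (fun x hx => hTm x (by rcases hx with rfl | ⟨c, rfl⟩ <;> simp [hT]))
      (fun x => by
        rw [sourceSigma_shift]
        exact hTm _ (by rcases x with i | i | c <;> simp [hT, shiftIndex]))
      hD.jointly_measurable_mark
  have h1 : D.occupancyLaw P t A = P {ω | (D.gap 0 ω, ω) ∈ S} := by
    rw [occupancyLaw, Measure.map_apply (hD.measurable_occupancy_apply t) MeasurableSet.of_discrete]
    -- Only almost sure equality holds: nonnegative gaps are needed to exclude arrivals before `gap
    -- 0`.
    refine measure_congr ?_
    filter_upwards [hD.ae_gap_nonneg] with ω hω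
    refine propext ?_
    change (fun k => D.occupancy t k ω) ∈ A ↔ (D.gap 0 ω, ω) ∈ S
    rw [hS, Set.mem_ofPred_eq]
    split_ifs with h
    · rw [show (fun k => D.occupancy t k ω) = _ from
        funext fun k => occupancy_eq_add_of_gap_le h k]
      rfl
    · rw [show (fun k => D.occupancy t k ω) = 0 from
        funext fun k => occupancy_eq_zero_of_lt_gap hω (not_le.1 h) k]
  rw [h1, measure_setOf_eq_lintegral_of_indep hmle (hD.measurable_gap 0) hind hSm, hD.gap_law 0]
  refine lintegral_congr fun u => ?_
  simp only [hS, Set.mem_ofPred_eq]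
  split_ifs with h
  · rw [postArrivalLaw, Measure.map_apply (hD.measurable_postArrival_add _) MeasurableSet.of_discrete]
    rfl
  · by_cases hA : (0 : Fin J → ℕ∞) ∈ A <;> simp [hA]

/-- The renewal equation at the first arrival. -/
theorem renewal [IsProbabilityMeasure P] (hD : IsBatchNetwork P rate batchLaw q D) (t : ℝ≥0)
    (A : Set (Fin J → ℕ∞)) :
    ENNReal.ofReal (Real.exp (rate * t)) * D.occupancyLaw P t A = A.indicator 1 0 +
      ∫⁻ s in Set.Icc 0 (t : ℝ),
        ENNReal.ofReal (rate * Real.exp (rate * s)) * D.postArrivalLaw P s.toNNReal A := by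
  rw [hD.occupancyLaw_eq_lintegral,
    ← setLIntegral_Iic_expMeasure_sub (hD.measurable_postArrivalLaw A),
    ← lintegral_add_compl _ (measurableSet_Iic (a := (t : ℝ))), Set.compl_Iic, mul_add, add_comm]
  congr 1
  -- No arrival by time `t` has probability `exp (-(rate * t))`, which the prefactor cancels.
  · rw [setLIntegral_congr_fun measurableSet_Ioi (g := fun _ => A.indicator 1 0)
      (fun u (hu : (t : ℝ) < u) => if_neg (not_le.2 hu)), setLIntegral_const,
      expMeasure_Ioi hD.rate_pos t.coe_nonneg, mul_left_comm, ← ENNReal.ofReal_mul (Real.exp_pos _).le,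
      ← Real.exp_add]
    simp
  · congr 1
    exact setLIntegral_congr_fun measurableSet_Iic fun u (hu : u ≤ (t : ℝ)) => if_pos hu

end IsBatchNetwork

/-! ### Independence and common law of the batches -/

namespace IsBatchNetwork

open BatchNetwork

variable {Ω : Type*} [MeasurableSpace Ω] {J : ℕ} {P : Measure Ω} {rate : ℝ}
  {batchLaw : Measure (Fin J → ℕ)} {q : Fin J → Fin J → ℝ≥0 → ℝ} {D : BatchNetwork Ω J}

theorem comap_batchOccupancy_le (hD : IsBatchNetwork P rate batchLaw q D) (i : ℕ) (s : ℝ≥0) :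
    MeasurableSpace.comap (D.batchOccupancy i s) inferInstance ≤
      ⨆ x ∈ batchSources J i, D.sourceSigma x := by
  have h := @measurable_batchOccupancy Ω J (⨆ x ∈ batchSources J i, D.sourceSigma x) D i
    (fun x hx => le_iSup₂_of_le x hx le_rfl) (hD.jointly_measurable_mark i)
  exact (@Measurable.comp _ _ _ (_) (_) _ (fun p : ℝ≥0 × Ω => D.batchOccupancy i p.1 p.2)
    (Prod.mk s) h (@measurable_prodMk_left _ _ _ (_) s)).comap_le

theorem comap_shift_occupancy_le (hD : IsBatchNetwork P rate batchLaw q D) (s : ℝ≥0) :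
    MeasurableSpace.comap (fun ω k => D.shift.occupancy s k ω) inferInstance ≤
      ⨆ x ∈ Set.range (shiftIndex (J := J)), D.sourceSigma x := by
  have h := @measurable_occupancy Ω J (⨆ x ∈ Set.range (shiftIndex (J := J)), D.sourceSigma x)
    D.shift (fun x => by
      rw [sourceSigma_shift]
      exact le_iSup₂_of_le _ (Set.mem_range_self x) le_rfl) hD.shift.jointly_measurable_mark
  exact (@Measurable.comp _ _ _ (_) (_) _ (fun p : ℝ≥0 × Ω => fun k => D.shift.occupancy p.1 k p.2)
    (Prod.mk s) h (@measurable_prodMk_left _ _ _ (_) s)).comap_le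

theorem indepFun_batchOccupancy_shift (hD : IsBatchNetwork P rate batchLaw q D) (s : ℝ≥0) :
    IndepFun (D.batchOccupancy 0 s) (fun ω k => D.shift.occupancy s k ω) P := by
  rw [IndepFun_iff_Indep]
  have hdisj : Disjoint (batchSources J 0) (Set.range shiftIndex) := by
    rw [Set.disjoint_left]
    rintro _ (rfl | ⟨c, rfl⟩) ⟨x, hx⟩ <;> rcases x with i | i | c <;> simp [shiftIndex] at hx
  exact indep_of_indep_of_le_left (indep_of_indep_of_le_right
    (indep_iSup_of_disjoint hD.sourceSigma_le hD.independent hdisj)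
    (hD.comap_shift_occupancy_le s)) (hD.comap_batchOccupancy_le 0 s)

theorem postArrivalLaw_apply [IsProbabilityMeasure P] (hD : IsBatchNetwork P rate batchLaw q D)
    (s : ℝ≥0) (A : Set (Fin J → ℕ∞)) :
    D.postArrivalLaw P s A =
      ∫⁻ c, D.shift.occupancyLaw P s {n | c + n ∈ A} ∂(P.map (D.batchOccupancy 0 s)) := by
  rw [postArrivalLaw, Measure.map_apply (hD.measurable_postArrival_add s) MeasurableSet.of_discrete]
  have h := measure_setOf_eq_lintegral_of_indepFun (hD.measurable_batchOccupancy_apply 0 s)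
    (hD.shift.measurable_occupancy_apply s) (hD.indepFun_batchOccupancy_shift s)
    (S := {p | p.1 + p.2 ∈ A}) MeasurableSet.of_discrete
  refine h.trans (lintegral_congr fun c => ?_)
  rw [occupancyLaw, Measure.map_apply (hD.shift.measurable_occupancy_apply s)
    MeasurableSet.of_discrete]
  rfl

end IsBatchNetwork

/-- The discrete σ-algebra on the states of a customer. -/
local instance optionMeasurableSpace {α : Type*} : MeasurableSpace (Option α) := ⊤

namespace IsBatchNetwork

open BatchNetwork

variable {Ω : Type*} [MeasurableSpace Ω] {J : ℕ} {P : Measure Ω} {rate : ℝ}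
  {batchLaw : Measure (Fin J → ℕ)} {q : Fin J → Fin J → ℝ≥0 → ℝ} {D : BatchNetwork Ω J}

theorem measurable_mark_apply (hD : IsBatchNetwork P rate batchLaw q D) (i : ℕ) (j : Fin J) (l : ℕ)
    (s : ℝ≥0) : Measurable (D.mark i j l s) :=
  measurable_to_countable' fun o => hD.measurableSet_mark_eq i j l s o

theorem iIndepFun_mark (hD : IsBatchNetwork P rate batchLaw q D) (i : ℕ) (s : ℝ≥0) :
    iIndepFun (fun c : Fin J × ℕ => D.mark i c.1 c.2 s) P := by
  rw [iIndepFun_iff_iIndep]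
  have hinj : Function.Injective fun c : Fin J × ℕ =>
      (.inr (.inr (i, c)) : ℕ ⊕ ℕ ⊕ (ℕ × Fin J × ℕ)) := fun c c' h => by simpa using h
  have h := (iIndep_iff _ _).1 (hD.independent.precomp hinj)
  rw [iIndep_iff]
  exact fun S f hf => h S fun c hc => (le_iSup (fun t : ℝ≥0 =>
    MeasurableSpace.comap (D.mark i c.1 c.2 t) ⊤) s) _ (hf c hc)

theorem indepFun_batch_mark (hD : IsBatchNetwork P rate batchLaw q D) (i : ℕ) (s : ℝ≥0) :
    IndepFun (D.batch i) (fun ω (c : Fin J × ℕ) => D.mark i c.1 c.2 s ω) P := by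
  rw [IndepFun_iff_Indep]
  have hdisj : Disjoint {(.inr (.inl i) : ℕ ⊕ ℕ ⊕ (ℕ × Fin J × ℕ))}
      (Set.range fun c => .inr (.inr (i, c))) := by simp
  have h := indep_iSup_of_disjoint hD.sourceSigma_le hD.independent hdisj
  simp only [Set.mem_singleton_iff, iSup_iSup_eq_left, iSup_range] at h
  refine indep_of_indep_of_le_right h ?_
  refine (@measurable_pi_lambda _ _ _ (_) _ _ fun c => ?_).comap_le
  refine Measurable.mono (comap_measurable _) ((le_iSup (fun t : ℝ≥0 =>
    MeasurableSpace.comap (D.mark i c.1 c.2 t) ⊤) s).trans ?_) le_rfl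
  exact le_iSup (fun c : Fin J × ℕ => D.markSigma i c.1 c.2) c

theorem map_mark_eq [IsProbabilityMeasure P] (hD : IsBatchNetwork P rate batchLaw q D) (i i' : ℕ)
    (j : Fin J) (l : ℕ) (s : ℝ≥0) : P.map (D.mark i j l s) = P.map (D.mark i' j l s) := by
  have hsome : ∀ k, P.map (D.mark i j l s) {some k} = P.map (D.mark i' j l s) {some k} := by
    intro k
    have h : P.real {ω | D.mark i j l s ω = some k} = P.real {ω | D.mark i' j l s ω = some k} := by
      rw [hD.mark_law, hD.mark_law]
    rw [Measure.map_apply (hD.measurable_mark_apply i j l s) MeasurableSet.of_discrete,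
      Measure.map_apply (hD.measurable_mark_apply i' j l s) MeasurableSet.of_discrete]
    exact (measureReal_eq_measureReal_iff).1 h
  have := Measure.isProbabilityMeasure_map (μ := P) (hD.measurable_mark_apply i j l s).aemeasurable
  have := Measure.isProbabilityMeasure_map (μ := P) (hD.measurable_mark_apply i' j l s).aemeasurable
  refine Measure.ext_of_singleton fun o => ?_
  rcases o with _ | k
  · have hc : ({none} : Set (Option (Fin J))) = (⋃ k, {some k})ᶜ := by
      ext o; rcases o <;> simp
    rw [hc, prob_compl_eq_one_sub MeasurableSet.of_discrete,
      prob_compl_eq_one_sub MeasurableSet.of_discrete,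
      measure_iUnion (fun a b h => by simpa using h) fun _ => MeasurableSet.of_discrete,
      measure_iUnion (fun a b h => by simpa using h) fun _ => MeasurableSet.of_discrete]
    simp_rw [hsome]
  · exact hsome k

/-- The state of a batch at a fixed age has the same law for all batches. -/
theorem map_batchOccupancy_eq [IsProbabilityMeasure P] (hD : IsBatchNetwork P rate batchLaw q D)
    (i i' : ℕ) (s : ℝ≥0) : P.map (D.batchOccupancy i s) = P.map (D.batchOccupancy i' s) := by
  -- The state of a batch is a fixed function `Φ` of its sizes and marks, whose joint law is a
  -- product of factors that do not depend on the batch.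
  set Φ : (Fin J → ℕ) × (Fin J × ℕ → Option (Fin J)) → Fin J → ℕ∞ := fun p k =>
    {c : Fin J × ℕ | c.2 < p.1 c.1 ∧ p.2 c = some k}.encard with hΦ
  have hΦm : Measurable Φ := by
    refine measurable_pi_lambda _ fun k => measurable_encard.comp (measurable_set_iff.2 fun c => ?_)
    refine measurableSet_setOfPred.1 (MeasurableSet.inter ?_ ?_)
    · exact measurableSet_lt measurable_const ((measurable_pi_apply c.1).comp measurable_fst)
    · have h : Measurable fun p : (Fin J → ℕ) × (Fin J × ℕ → Option (Fin J)) => p.2 c :=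
        (measurable_pi_apply c).comp measurable_snd
      exact h (MeasurableSet.of_discrete (s := {some k}))
  have hM : ∀ i, Measurable fun ω (c : Fin J × ℕ) => D.mark i c.1 c.2 s ω := fun i =>
    measurable_pi_lambda _ fun c => hD.measurable_mark_apply i c.1 c.2 s
  have key : ∀ i, P.map (D.batchOccupancy i s) = (batchLaw.prod (Measure.infinitePi fun c =>
      P.map (D.mark i c.1 c.2 s))).map Φ := by
    intro i
    have h := (hD.iIndepFun_mark i s).map_fun_eq_infinitePi_map
      fun c : Fin J × ℕ => hD.measurable_mark_apply i c.1 c.2 s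
    rw [← h, ← hD.batch_law i,
      ← (indepFun_iff_map_prod_eq_prod_map_map (hD.measurable_batch i).aemeasurable
        (hM i).aemeasurable).1 (hD.indepFun_batch_mark i s),
      Measure.map_map hΦm ((hD.measurable_batch i).prodMk (hM i))]
    rfl
  rw [key i, key i']
  congr 3
  exact funext fun c : Fin J × ℕ => hD.map_mark_eq i i' c.1 c.2 s

end IsBatchNetwork

/-! ### Comparison of laws by iterating the renewal equation -/

theorem setLIntegral_Ioc_mul_exp {r : ℝ} (hr : 0 < r) {a b : ℝ} (hab : a ≤ b) :
    ∫⁻ s in Set.Ioc a b, ENNReal.ofReal (r * Real.exp (r * s)) =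
      ENNReal.ofReal (Real.exp (r * b) - Real.exp (r * a)) := by
  have hc : Continuous fun s => r * Real.exp (r * s) := by fun_prop
  rw [← ofReal_integral_eq_lintegral_ofReal (hc.integrableOn_Ioc)
    (ae_of_all _ fun s => (mul_pos hr (Real.exp_pos _)).le),
    ← intervalIntegral.integral_of_le hab,
    intervalIntegral.integral_eq_sub_of_hasDerivAt (f := fun s => Real.exp (r * s))]
  · intro s _
    simpa [mul_comm] using ((hasDerivAt_id s).const_mul r).exp
  · exact hc.intervalIntegrable a b

theorem ENNReal.le_of_forall_le_add_pow {x y ρ : ℝ≥0∞} (hρ : ρ < 1)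
    (h : ∀ k : ℕ, x ≤ y + ρ ^ k) : x ≤ y := by
  have ht : Tendsto (fun k : ℕ => y + ρ ^ k) atTop (𝓝 (y + 0)) :=
    tendsto_const_nhds.add (ENNReal.tendsto_pow_atTop_nhds_zero_of_lt_one hρ)
  rw [add_zero] at ht
  exact ge_of_tendsto' ht h

theorem ENNReal.ofReal_one_sub_exp_neg_lt_one (x : ℝ) :
    ENNReal.ofReal (1 - Real.exp (-x)) < 1 := by
  rw [ENNReal.ofReal_lt_one]
  linarith [Real.exp_pos (-x)]

namespace IsBatchNetwork

open BatchNetwork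

variable {Ω : Type*} [MeasurableSpace Ω] {J : ℕ} {P : Measure Ω} {rate : ℝ}
  {batchLaw : Measure (Fin J → ℕ)} {q : Fin J → Fin J → ℝ≥0 → ℝ} {D : BatchNetwork Ω J}

theorem postArrivalLaw_le (hD : IsBatchNetwork P rate batchLaw q D) (s : ℝ≥0)
    (A : Set (Fin J → ℕ∞)) :
    D.postArrivalLaw P s A ≤
      D.shift.occupancyLaw P s A + P.map (D.batchOccupancy 0 s) {0}ᶜ := by
  rw [postArrivalLaw, occupancyLaw,
    Measure.map_apply (hD.measurable_postArrival_add s) MeasurableSet.of_discrete,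
    Measure.map_apply (hD.shift.measurable_occupancy_apply s) MeasurableSet.of_discrete,
    Measure.map_apply (hD.measurable_batchOccupancy_apply 0 s) MeasurableSet.of_discrete]
  refine (measure_mono fun ω hω => ?_).trans (measure_union_le _ _)
  by_cases h0 : D.batchOccupancy 0 s ω = 0
  · left
    rw [Set.mem_preimage, h0, zero_add] at hω
    exact hω
  · exact Or.inr h0

theorem postArrivalLaw_infinite_le (hD : IsBatchNetwork P rate batchLaw q D) (s : ℝ≥0) :
    D.postArrivalLaw P s {n | ∃ k, n k = ⊤} ≤ D.shift.occupancyLaw P s {n | ∃ k, n k = ⊤} := by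
  rw [postArrivalLaw, occupancyLaw,
    Measure.map_apply (hD.measurable_postArrival_add s) MeasurableSet.of_discrete,
    Measure.map_apply (hD.shift.measurable_occupancy_apply s) MeasurableSet.of_discrete]
  refine measure_mono ?_
  rintro ω ⟨k, hk⟩
  refine ⟨k, ?_⟩
  change D.batchOccupancy 0 s ω k + D.shift.occupancy s k ω = ⊤ at hk
  rw [ENat.add_eq_top] at hk
  exact hk.resolve_left (batchOccupancy_ne_top D 0 s ω k)

/-- Conditionally on the first batch, whose law is the same in both networks, `A` becomes a
translated set; uniformity of the hypothesis over all sets keeps the error at `ε`. -/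
theorem shift_postArrivalLaw_le [IsProbabilityMeasure P] (hD : IsBatchNetwork P rate batchLaw q D)
    {s : ℝ≥0} {ε : ℝ≥0∞}
    (h : ∀ A, D.shift.shift.occupancyLaw P s A ≤ D.shift.occupancyLaw P s A + ε)
    (A : Set (Fin J → ℕ∞)) :
    D.shift.postArrivalLaw P s A ≤ D.postArrivalLaw P s A + ε := by
  have := Measure.isProbabilityMeasure_map (μ := P)
    (hD.measurable_batchOccupancy_apply 0 s).aemeasurable
  have hmap : P.map (D.shift.batchOccupancy 0 s) = P.map (D.batchOccupancy 0 s) :=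
    hD.map_batchOccupancy_eq 1 0 s
  rw [hD.shift.postArrivalLaw_apply, hD.postArrivalLaw_apply, hmap]
  refine (lintegral_mono fun c => h _).trans ?_
  rw [lintegral_add_right _ measurable_const, lintegral_const, measure_univ, mul_one]

theorem renewal_Ioc [IsProbabilityMeasure P] (hD : IsBatchNetwork P rate batchLaw q D) (t : ℝ≥0)
    (A : Set (Fin J → ℕ∞)) :
    ENNReal.ofReal (Real.exp (rate * t)) * D.occupancyLaw P t A = A.indicator 1 0 +
      ∫⁻ s in Set.Ioc 0 (t : ℝ),
        ENNReal.ofReal (rate * Real.exp (rate * s)) * D.postArrivalLaw P s.toNNReal A := by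
  rw [hD.renewal, setLIntegral_congr Ioc_ae_eq_Icc]

theorem renewal_of_le [IsProbabilityMeasure P] (hD : IsBatchNetwork P rate batchLaw q D)
    {t t' : ℝ≥0} (ht : t ≤ t') (A : Set (Fin J → ℕ∞)) :
    ENNReal.ofReal (Real.exp (rate * t')) * D.occupancyLaw P t' A =
      ENNReal.ofReal (Real.exp (rate * t)) * D.occupancyLaw P t A +
      ∫⁻ s in Set.Ioc (t : ℝ) t',
        ENNReal.ofReal (rate * Real.exp (rate * s)) * D.postArrivalLaw P s.toNNReal A := by
  rw [hD.renewal_Ioc, hD.renewal_Ioc, add_assoc,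
    ← Set.Ioc_union_Ioc_eq_Ioc t.coe_nonneg (NNReal.coe_le_coe.2 ht),
    lintegral_union measurableSet_Ioc (Set.Ioc_disjoint_Ioc_of_le le_rfl)]

/-- The renewal equation on `(t, t']` is a weighted average with weights summing to `exp (rate *
t')`. The factor it puts before `κ` is less than one, which makes the bound iterable. -/
theorem occupancyLaw_le_of_postArrivalLaw_le [IsProbabilityMeasure P]
    (hD : IsBatchNetwork P rate batchLaw q D) {t t' : ℝ≥0} (ht : t ≤ t') {A : Set (Fin J → ℕ∞)}
    {κ : ℝ≥0∞} {g : ℝ → ℝ≥0∞}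
    (h : ∀ s ∈ Set.Ioc (t : ℝ) t',
      D.postArrivalLaw P s.toNNReal A ≤ D.occupancyLaw P t A + κ + g s) :
    D.occupancyLaw P t' A ≤ D.occupancyLaw P t A +
      ENNReal.ofReal (1 - Real.exp (-(rate * (t' - t)))) * κ +
      ENNReal.ofReal rate * ∫⁻ s in Set.Ioc (t : ℝ) t', g s := by
  have hr := hD.rate_pos
  have htt : rate * t ≤ rate * t' := mul_le_mul_of_nonneg_left (NNReal.coe_le_coe.2 ht) hr.le
  have hE0 : ENNReal.ofReal (Real.exp (rate * t')) ≠ 0 := by simp [Real.exp_pos]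
  have hint : ∫⁻ s in Set.Ioc (t : ℝ) t',
      ENNReal.ofReal (rate * Real.exp (rate * s)) * D.postArrivalLaw P s.toNNReal A ≤
      ENNReal.ofReal (Real.exp (rate * t') - Real.exp (rate * t)) * (D.occupancyLaw P t A + κ) +
      ENNReal.ofReal (Real.exp (rate * t')) *
        (ENNReal.ofReal rate * ∫⁻ s in Set.Ioc (t : ℝ) t', g s) := by
    have hw : Measurable fun s => ENNReal.ofReal (rate * Real.exp (rate * s)) := by fun_prop
    rw [← setLIntegral_Ioc_mul_exp hr (NNReal.coe_le_coe.2 ht), ← lintegral_mul_const _ hw,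
      ← mul_assoc, ← lintegral_const_mul' _ _ (ENNReal.mul_ne_top ENNReal.ofReal_ne_top
        ENNReal.ofReal_ne_top), ← lintegral_add_left (hw.mul_const _)]
    refine setLIntegral_mono' measurableSet_Ioc fun s hs => ?_
    refine (mul_le_mul_right (h s hs) _).trans ?_
    rw [mul_add]
    refine add_le_add le_rfl (mul_le_mul_left ?_ _)
    rw [← ENNReal.ofReal_mul (Real.exp_pos _).le, mul_comm rate]
    refine ENNReal.ofReal_le_ofReal (mul_le_mul_of_nonneg_right (Real.exp_le_exp.2 ?_) hr.le)
    exact mul_le_mul_of_nonneg_left hs.2 hr.le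
  have hsub : ENNReal.ofReal (Real.exp (rate * t') - Real.exp (rate * t)) =
      ENNReal.ofReal (Real.exp (rate * t')) *
        ENNReal.ofReal (1 - Real.exp (-(rate * (t' - t)))) := by
    rw [← ENNReal.ofReal_mul (Real.exp_pos _).le, mul_sub, mul_one, ← Real.exp_add]
    congr 3
    ring
  have hsum : ENNReal.ofReal (Real.exp (rate * t)) +
      ENNReal.ofReal (Real.exp (rate * t') - Real.exp (rate * t)) =
      ENNReal.ofReal (Real.exp (rate * t')) := by
    rw [← ENNReal.ofReal_add (Real.exp_pos _).le (sub_nonneg.2 (Real.exp_le_exp.2 htt))]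
    congr 1
    ring
  rw [← ENNReal.mul_le_mul_iff_right hE0 ENNReal.ofReal_ne_top, hD.renewal_of_le ht]
  refine (add_le_add le_rfl hint).trans (le_of_eq ?_)
  rw [← add_assoc, mul_add, ← add_assoc, ← add_mul, hsum, hsub]
  ring

theorem occupancyLaw_zero [IsProbabilityMeasure P] (hD : IsBatchNetwork P rate batchLaw q D)
    (A : Set (Fin J → ℕ∞)) : D.occupancyLaw P 0 A = A.indicator 1 0 := by
  simpa using hD.renewal_Ioc 0 A

/-- Almost surely, only finitely many customers are in the network. -/
theorem occupancyLaw_infinite [IsProbabilityMeasure P] (hD : IsBatchNetwork P rate batchLaw q D)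
    (t : ℝ≥0) : D.occupancyLaw P t {n | ∃ k, n k = ⊤} = 0 := by
  set ρ := ENNReal.ofReal (1 - Real.exp (-(rate * t))) with hρ
  -- The induction ranges over all networks because each step passes from `D` to `D.shift`. The
  -- first batch is finite, so it cannot create an infinite queue.
  have key : ∀ k : ℕ, ∀ D : BatchNetwork Ω J, IsBatchNetwork P rate batchLaw q D → ∀ s ≤ t,
      D.occupancyLaw P s {n | ∃ k, n k = ⊤} ≤ ρ ^ k := by
    intro k
    induction k with
    | zero =>
      intro D hD s _
      have := hD.isProbabilityMeasure_occupancyLaw s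
      simpa using prob_le_one
    | succ k ih =>
      intro D hD s hs
      have h0 : D.occupancyLaw P 0 {n | ∃ k, n k = ⊤} = 0 := by
        rw [hD.occupancyLaw_zero, Set.indicator_of_notMem]
        simp
      have h := hD.occupancyLaw_le_of_postArrivalLaw_le (show 0 ≤ s from zero_le) (κ := ρ ^ k) (g := 0)
        (A := {n | ∃ k, n k = ⊤}) (fun u hu => by
          rw [h0, zero_add, Pi.zero_apply, add_zero]
          exact (hD.postArrivalLaw_infinite_le _).trans
            (ih _ hD.shift _ ((Real.toNNReal_le_iff_le_coe.2 hu.2).trans hs)))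
      refine h.trans ?_
      simp only [h0, NNReal.coe_zero, sub_zero, zero_add, Pi.zero_apply, lintegral_zero, mul_zero,
        add_zero, pow_succ']
      refine mul_le_mul_left (ENNReal.ofReal_le_ofReal ?_) _
      gcongr
      exact hD.rate_pos.le
  exact le_antisymm (ENNReal.le_of_forall_le_add_pow (ENNReal.ofReal_one_sub_exp_neg_lt_one _)
    fun k => by simpa using key k D hD t le_rfl) zero_le

/-- Both networks satisfy renewal equations with the same rate and batch law, so each iteration
shrinks their discrepancy on `[0, t]` by `ρ < 1`. Taking complements, the inequality for all `A` is
in fact an equality. -/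
theorem shift_occupancyLaw_le [IsProbabilityMeasure P] (hD : IsBatchNetwork P rate batchLaw q D)
    (t : ℝ≥0) (A : Set (Fin J → ℕ∞)) : D.shift.occupancyLaw P t A ≤ D.occupancyLaw P t A := by
  set ρ := ENNReal.ofReal (1 - Real.exp (-(rate * t))) with hρ
  have key : ∀ k : ℕ, ∀ D : BatchNetwork Ω J, IsBatchNetwork P rate batchLaw q D → ∀ s ≤ t,
      ∀ A, D.shift.occupancyLaw P s A ≤ D.occupancyLaw P s A + ρ ^ k := by
    intro k
    induction k with
    | zero =>
      intro D hD s _ A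
      have := hD.shift.isProbabilityMeasure_occupancyLaw s
      exact prob_le_one.trans (by simp)
    | succ k ih =>
      intro D hD s hs A
      have hr := hD.rate_pos
      have hE0 : ENNReal.ofReal (Real.exp (rate * s)) ≠ 0 := by simp [Real.exp_pos]
      have hw : Measurable fun s => ENNReal.ofReal (rate * Real.exp (rate * s)) := by fun_prop
      rw [← ENNReal.mul_le_mul_iff_right hE0 ENNReal.ofReal_ne_top, mul_add, hD.renewal_Ioc,
        hD.shift.renewal_Ioc, add_assoc]
      refine add_le_add le_rfl ?_
      calc ∫⁻ u in Set.Ioc 0 (s : ℝ), ENNReal.ofReal (rate * Real.exp (rate * u)) *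
            D.shift.postArrivalLaw P u.toNNReal A
          ≤ ∫⁻ u in Set.Ioc 0 (s : ℝ), (ENNReal.ofReal (rate * Real.exp (rate * u)) *
            D.postArrivalLaw P u.toNNReal A +
              ENNReal.ofReal (rate * Real.exp (rate * u)) * ρ ^ k) := by
            refine setLIntegral_mono' measurableSet_Ioc fun u hu => ?_
            rw [← mul_add]
            exact mul_le_mul_right (hD.shift_postArrivalLaw_le (fun A => ih _ hD.shift _
              ((Real.toNNReal_le_iff_le_coe.2 hu.2).trans hs) A) A) _
        _ = _ := lintegral_add_right _ (hw.mul_const _)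
        _ ≤ _ := by
            refine add_le_add le_rfl ?_
            rw [lintegral_mul_const _ hw, setLIntegral_Ioc_mul_exp hr s.coe_nonneg, pow_succ',
              ← mul_assoc, hρ, ← ENNReal.ofReal_mul (Real.exp_pos _).le]
            refine mul_le_mul_left (ENNReal.ofReal_le_ofReal ?_) _
            have h1 : Real.exp (-(rate * t)) ≤ Real.exp (-(rate * s)) := by gcongr
            have h2 : Real.exp (rate * s) * Real.exp (-(rate * s)) = 1 := by
              rw [← Real.exp_add]; simp
            have h3 := mul_le_mul_of_nonneg_left h1 (Real.exp_pos (rate * s)).le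
            rw [mul_zero, Real.exp_zero]
            linarith
  exact ENNReal.le_of_forall_le_add_pow (ENNReal.ofReal_one_sub_exp_neg_lt_one _)
    fun k => key k D hD t le_rfl A

/-- Grönwall by iteration: an excess of at most `κ` over the law at time `t` improves to `ρ * κ +
rate * B`. Interval length at most one makes `ρ` uniform. -/
theorem occupancyLaw_le_of_le_add_one [IsProbabilityMeasure P]
    (hD : IsBatchNetwork P rate batchLaw q D) {t t' : ℝ≥0} (ht : t ≤ t') (ht' : t' ≤ t + 1)
    (A : Set (Fin J → ℕ∞)) :
    D.occupancyLaw P t' A ≤ D.occupancyLaw P t A + ENNReal.ofReal (rate * Real.exp rate) *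
      ∫⁻ s in Set.Ioc (t : ℝ) t', P.map (D.batchOccupancy 0 s.toNNReal) {0}ᶜ := by
  set B := ∫⁻ s in Set.Ioc (t : ℝ) t', P.map (D.batchOccupancy 0 s.toNNReal) {0}ᶜ with hB
  set M := ENNReal.ofReal (rate * Real.exp rate) with hM
  set ρ := ENNReal.ofReal (1 - Real.exp (-rate)) with hρ
  have hr := hD.rate_pos
  -- `M` is the fixed point of `x ↦ ρ * x + rate`, so the constant before `B` is preserved by the
  -- iteration.
  have hfix : ρ * M + ENNReal.ofReal rate = M := by
    rw [hρ, hM, ← ENNReal.ofReal_mul, ← ENNReal.ofReal_add]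
    · congr 1
      have h2 : Real.exp (-rate) * Real.exp rate = 1 := by rw [← Real.exp_add]; simp
      linear_combination (-rate) * h2
    · exact mul_nonneg (by simp [hr.le]) (by positivity)
    · exact hr.le
    · simp [hr.le]
  have key : ∀ k : ℕ, ∀ s, t ≤ s → s ≤ t' →
      D.occupancyLaw P s A ≤ D.occupancyLaw P t A + (M * B + ρ ^ k) := by
    intro k
    induction k with
    | zero =>
      intro s _ _
      have := hD.isProbabilityMeasure_occupancyLaw s
      exact prob_le_one.trans (by rw [pow_zero, ← add_assoc]; exact le_add_self)
    | succ k ih =>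
      intro s hs hs'
      have h := hD.occupancyLaw_le_of_postArrivalLaw_le hs (κ := M * B + ρ ^ k)
        (g := fun u => P.map (D.batchOccupancy 0 u.toNNReal) {0}ᶜ) (A := A) (fun u hu =>
          (hD.postArrivalLaw_le _ _).trans (add_le_add ((hD.shift_occupancyLaw_le _ _).trans
            (ih _ (NNReal.le_toNNReal_of_coe_le hu.1.le)
              ((Real.toNNReal_le_iff_le_coe.2 hu.2).trans hs'))) le_rfl))
      refine h.trans ?_
      rw [add_assoc]
      refine add_le_add le_rfl ?_
      have hB' : ∫⁻ u in Set.Ioc (t : ℝ) s, P.map (D.batchOccupancy 0 u.toNNReal) {0}ᶜ ≤ B :=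
        lintegral_mono_set (Set.Ioc_subset_Ioc_right (NNReal.coe_le_coe.2 hs'))
      have hρ' : ENNReal.ofReal (1 - Real.exp (-(rate * (s - t)))) ≤ ρ := by
        refine ENNReal.ofReal_le_ofReal (sub_le_sub_left (Real.exp_le_exp.2 ?_) _)
        have h1 : (s : ℝ) ≤ t + 1 := by exact_mod_cast hs'.trans ht'
        nlinarith
      calc _ ≤ ρ * (M * B + ρ ^ k) + ENNReal.ofReal rate * B := by gcongr
        _ = (ρ * M + ENNReal.ofReal rate) * B + ρ ^ (k + 1) := by ring
        _ = _ := by rw [hfix]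
  refine ENNReal.le_of_forall_le_add_pow (ENNReal.ofReal_one_sub_exp_neg_lt_one rate) fun k => ?_
  rw [add_assoc]
  exact key k t' ht le_rfl

/-- The law of the queue lengths changes, from one time to a later one, in total variation by no
more than a multiple of the integral of the probability that a batch has not yet left. -/
theorem occupancyLaw_le [IsProbabilityMeasure P] (hD : IsBatchNetwork P rate batchLaw q D)
    {t t' : ℝ≥0} (ht : t ≤ t') (A : Set (Fin J → ℕ∞)) :
    D.occupancyLaw P t' A ≤ D.occupancyLaw P t A + ENNReal.ofReal (rate * Real.exp rate) *
      ∫⁻ s in Set.Ioc (t : ℝ) t', P.map (D.batchOccupancy 0 s.toNNReal) {0}ᶜ := by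
  -- Cut into unit intervals: the integrals add up, so the constant does not grow with their number.
  obtain ⟨n, hn⟩ := exists_nat_ge t'
  have hn' : t' ≤ t + n := hn.trans le_add_self
  clear hn
  induction n generalizing t with
  | zero =>
    obtain rfl : t = t' := le_antisymm ht (by simpa using hn')
    exact le_self_add
  | succ n ih =>
    rcases le_total t' (t + 1) with h | h
    · exact hD.occupancyLaw_le_of_le_add_one ht h A
    · have h1 := hD.occupancyLaw_le_of_le_add_one (t := t) (t' := t + 1) le_self_add le_rfl A
      have h2 := ih h (by rw [add_assoc, add_comm 1]; exact_mod_cast hn')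
      refine h2.trans ((add_le_add h1 le_rfl).trans (le_of_eq ?_))
      rw [← Set.Ioc_union_Ioc_eq_Ioc (NNReal.coe_le_coe.2 (le_self_add : t ≤ t + 1))
        (NNReal.coe_le_coe.2 h), lintegral_union measurableSet_Ioc
        (Set.Ioc_disjoint_Ioc_of_le le_rfl), mul_add, add_assoc]

end IsBatchNetwork

/-! ### Integrability of the survival probability of a batch -/

/-- The two terms of the minimum cross at `s = y / δ`; the exponential tail beyond contributes `1 /
δ`. -/
theorem lintegral_min_one_exp_le {δ y : ℝ} (hδ : 0 < δ) (hy : 0 ≤ y) :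
    ∫⁻ s in Set.Ioi (0 : ℝ), ENNReal.ofReal (min 1 (Real.exp (y - δ * s))) ≤
      ENNReal.ofReal (y / δ + 1 / δ) := by
  have ha : 0 ≤ y / δ := div_nonneg hy hδ.le
  rw [← Set.Ioc_union_Ioi_eq_Ioi ha, lintegral_union measurableSet_Ioi
    (Set.Ioc_disjoint_Ioi le_rfl), ENNReal.ofReal_add ha (by positivity)]
  refine add_le_add ?_ ?_
  · calc _ ≤ ∫⁻ s in Set.Ioc 0 (y / δ), 1 :=
          lintegral_mono fun s => by simp
      _ = _ := by simp
  · have heq : (fun s => Real.exp (y - δ * s)) = fun s => Real.exp y * Real.exp (-δ * s) := by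
      funext s
      rw [← Real.exp_add]
      congr 1
      ring
    have hint : IntegrableOn (fun s => Real.exp (y - δ * s)) (Set.Ioi (y / δ)) := by
      rw [heq]
      exact (integrableOn_exp_mul_Ioi (neg_lt_zero.2 hδ) _).const_mul _
    calc _ ≤ ∫⁻ s in Set.Ioi (y / δ), ENNReal.ofReal (Real.exp (y - δ * s)) :=
          lintegral_mono fun s => ENNReal.ofReal_le_ofReal (min_le_right _ _)
      _ = ENNReal.ofReal (∫ s in Set.Ioi (y / δ), Real.exp (y - δ * s)) :=
          (ofReal_integral_eq_lintegral_ofReal hint (ae_of_all _ fun s => (Real.exp_pos _).le)).symm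
      _ ≤ _ := by
          refine ENNReal.ofReal_le_ofReal (le_of_eq ?_)
          rw [heq, integral_const_mul, integral_exp_mul_Ioi (neg_lt_zero.2 hδ), neg_div_neg_eq,
            ← mul_div_assoc, ← Real.exp_add, neg_mul, mul_div_cancel₀ _ hδ.ne', add_neg_cancel,
            Real.exp_zero]

namespace IsBatchNetwork

open BatchNetwork

variable {Ω : Type*} [MeasurableSpace Ω] {J : ℕ} {P : Measure Ω} {rate : ℝ}
  {batchLaw : Measure (Fin J → ℕ)} {q : Fin J → Fin J → ℝ≥0 → ℝ} {D : BatchNetwork Ω J}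

theorem measure_mark_ne_none_le [IsProbabilityMeasure P] (hD : IsBatchNetwork P rate batchLaw q D)
    (i : ℕ) (j : Fin J) (l : ℕ) (s : ℝ≥0) :
    P {ω | D.mark i j l s ω ≠ none} ≤ ENNReal.ofReal (occupancyTail q j s) := by
  have hset : {ω | D.mark i j l s ω ≠ none} = ⋃ k, {ω | D.mark i j l s ω = some k} := by
    ext ω
    rcases h : D.mark i j l s ω <;> simp [h]
  rw [hset, occupancyTail, ENNReal.ofReal_sum_of_nonneg fun k _ => by
    rw [← hD.mark_law i j l k s]; exact measureReal_nonneg]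
  refine (measure_iUnion_fintype_le _ _).trans (le_of_eq (Finset.sum_congr rfl fun k _ => ?_))
  rw [← hD.mark_law i j l k s, ofReal_measureReal]

/-- The probability that some customer of a batch is still in the network, by the size of the
batch. -/
theorem map_batchOccupancy_compl_zero_le [IsProbabilityMeasure P]
    (hD : IsBatchNetwork P rate batchLaw q D) (s : ℝ≥0) :
    P.map (D.batchOccupancy 0 s) {0}ᶜ ≤
      ∫⁻ S, min 1 (∑ j, (S j : ℝ≥0∞) * ENNReal.ofReal (occupancyTail q j s)) ∂batchLaw := by
  have hM : Measurable fun ω (c : Fin J × ℕ) => D.mark 0 c.1 c.2 s ω :=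
    measurable_pi_lambda _ fun c => hD.measurable_mark_apply 0 c.1 c.2 s
  have hSm : MeasurableSet {p : (Fin J → ℕ) × (Fin J × ℕ → Option (Fin J)) |
      ∃ c : Fin J × ℕ, c.2 < p.1 c.1 ∧ p.2 c ≠ none} := by
    rw [Set.ofPred_exists]
    refine MeasurableSet.iUnion fun c => MeasurableSet.inter ?_ ?_
    · exact measurableSet_lt measurable_const ((measurable_pi_apply c.1).comp measurable_fst)
    · have h : Measurable fun p : (Fin J → ℕ) × (Fin J × ℕ → Option (Fin J)) => p.2 c :=
        (measurable_pi_apply c).comp measurable_snd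
      exact h (MeasurableSet.of_discrete (s := {none}ᶜ))
  rw [Measure.map_apply (hD.measurable_batchOccupancy_apply 0 s) MeasurableSet.of_discrete]
  calc P (D.batchOccupancy 0 s ⁻¹' {0}ᶜ)
      ≤ P {ω | ∃ c : Fin J × ℕ, c.2 < D.batch 0 ω c.1 ∧ D.mark 0 c.1 c.2 s ω ≠ none} := by
        refine measure_mono fun ω hω => ?_
        by_contra hcon
        refine hω (funext fun k => ?_)
        rw [batchOccupancy, Pi.zero_apply, Set.encard_eq_zero, Set.eq_empty_iff_forall_notMem]
        rintro c ⟨hc, hk⟩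
        exact hcon ⟨c, hc, by simp [hk]⟩
    _ = ∫⁻ S, P {ω | ∃ c : Fin J × ℕ, c.2 < S c.1 ∧ D.mark 0 c.1 c.2 s ω ≠ none} ∂batchLaw := by
        rw [← hD.batch_law 0]
        exact measure_setOf_eq_lintegral_of_indepFun (hD.measurable_batch 0) hM
          (hD.indepFun_batch_mark 0 s) hSm
    _ ≤ _ := by
        refine lintegral_mono fun S => le_min prob_le_one ?_
        calc _ ≤ P (⋃ j, ⋃ l ∈ Finset.range (S j), {ω | D.mark 0 j l s ω ≠ none}) := by
              refine measure_mono ?_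
              rintro ω ⟨⟨j, l⟩, hl, h⟩
              simp only [Set.mem_iUnion, Finset.mem_range]
              exact ⟨j, l, hl, h⟩
          _ ≤ ∑ j, ∑ l ∈ Finset.range (S j), P {ω | D.mark 0 j l s ω ≠ none} :=
              (measure_iUnion_fintype_le _ _).trans
                (Finset.sum_le_sum fun j _ => measure_biUnion_finset_le _ _)
          _ ≤ ∑ j, ∑ l ∈ Finset.range (S j), ENNReal.ofReal (occupancyTail q j s) :=
              Finset.sum_le_sum fun j _ => Finset.sum_le_sum fun l _ =>
                hD.measure_mark_ne_none_le 0 j l s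
          _ = _ := by simp

/-- Ages up to `t₀` contribute at most `t₀`. Beyond, `exp (Y S)` is the batch size plus one, so
survival to age `s` is bounded by the mean of `min 1 (exp (Y S - δ * s))`; Tonelli reduces the
integral to the mean of `Y S / δ + 1 / δ`. -/
theorem lintegral_map_batchOccupancy_ne_top [IsProbabilityMeasure P]
    (hD : IsBatchNetwork P rate batchLaw q D) (hQ : ExponentiallyBoundedTails q)
    (hS : Integrable (fun s : Fin J → ℕ => Real.log ((∑ j, (s j : ℝ)) + 1)) batchLaw) :
    ∫⁻ s in Set.Ioi (0 : ℝ), P.map (D.batchOccupancy 0 s.toNNReal) {0}ᶜ ≠ ∞ := by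
  obtain ⟨δ, hδ, t₀, -, hQ⟩ := hQ
  have hprob : IsProbabilityMeasure batchLaw := by
    rw [← hD.batch_law 0]
    exact Measure.isProbabilityMeasure_map (hD.measurable_batch 0).aemeasurable
  have hprob' : ∀ s, IsProbabilityMeasure (P.map (D.batchOccupancy 0 s)) := fun s =>
    Measure.isProbabilityMeasure_map (hD.measurable_batchOccupancy_apply 0 s).aemeasurable
  set Y : (Fin J → ℕ) → ℝ := fun S => Real.log ((∑ j, (S j : ℝ)) + 1) with hY
  have hx : ∀ S : Fin J → ℕ, 0 ≤ ∑ j, (S j : ℝ) := fun S =>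
    Finset.sum_nonneg fun j _ => Nat.cast_nonneg _
  have hY0 : ∀ S, 0 ≤ Y S := fun S => Real.log_nonneg (by linarith [hx S])
  have hbound : ∀ s ∈ Set.Ioi (t₀ : ℝ), P.map (D.batchOccupancy 0 s.toNNReal) {0}ᶜ ≤
      ∫⁻ S, ENNReal.ofReal (min 1 (Real.exp (Y S - δ * s))) ∂batchLaw := by
    intro s hs
    have hs0 : 0 ≤ s := t₀.coe_nonneg.trans (le_of_lt hs)
    refine (hD.map_batchOccupancy_compl_zero_le _).trans (lintegral_mono fun S => ?_)
    rw [ENNReal.ofReal_min, ENNReal.ofReal_one]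
    refine min_le_min le_rfl ?_
    calc _ ≤ ∑ j, (S j : ℝ≥0∞) * ENNReal.ofReal (Real.exp (-δ * s)) := by
          refine Finset.sum_le_sum fun j _ => mul_le_mul_right (ENNReal.ofReal_le_ofReal ?_) _
          have h := hQ s.toNNReal (NNReal.le_toNNReal_of_coe_le (le_of_lt hs)) j
          rwa [Real.coe_toNNReal s hs0] at h
      _ = ENNReal.ofReal ((∑ j, (S j : ℝ)) * Real.exp (-δ * s)) := by
          rw [← Finset.sum_mul, ENNReal.ofReal_mul (hx S),
            ENNReal.ofReal_sum_of_nonneg fun j _ => Nat.cast_nonneg _]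
          simp
      _ ≤ _ := by
          refine ENNReal.ofReal_le_ofReal ?_
          rw [sub_eq_add_neg, Real.exp_add, hY, Real.exp_log (by linarith [hx S]), neg_mul]
          exact mul_le_mul_of_nonneg_right (by linarith) (Real.exp_pos _).le
  have hYm : Measurable Y := measurable_of_countable _
  have htail : ∫⁻ s in Set.Ioi (t₀ : ℝ), P.map (D.batchOccupancy 0 s.toNNReal) {0}ᶜ ≤
      ∫⁻ S, ENNReal.ofReal (Y S / δ + 1 / δ) ∂batchLaw := by
    calc _ ≤ ∫⁻ s in Set.Ioi (t₀ : ℝ),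
          ∫⁻ S, ENNReal.ofReal (min 1 (Real.exp (Y S - δ * s))) ∂batchLaw :=
          setLIntegral_mono' measurableSet_Ioi hbound
      _ ≤ ∫⁻ s in Set.Ioi (0 : ℝ),
          ∫⁻ S, ENNReal.ofReal (min 1 (Real.exp (Y S - δ * s))) ∂batchLaw :=
          lintegral_mono_set (Set.Ioi_subset_Ioi t₀.coe_nonneg)
      _ = ∫⁻ S, (∫⁻ s in Set.Ioi (0 : ℝ), ENNReal.ofReal (min 1 (Real.exp (Y S - δ * s))))
          ∂batchLaw := by
          refine lintegral_lintegral_swap (Measurable.aemeasurable ?_)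
          exact (measurable_const.min (Real.measurable_exp.comp
            ((hYm.comp measurable_snd).sub (measurable_fst.const_mul δ)))).ennreal_ofReal
      _ ≤ _ := lintegral_mono fun S => lintegral_min_one_exp_le hδ (hY0 S)
  have hfin : ∫⁻ S, ENNReal.ofReal (Y S / δ + 1 / δ) ∂batchLaw ≠ ∞ :=
    (((hS.div_const δ).add (integrable_const (1 / δ))).lintegral_lt_top).ne
  rw [← Set.Ioc_union_Ioi_eq_Ioi t₀.coe_nonneg, lintegral_union measurableSet_Ioi
    (Set.Ioc_disjoint_Ioi le_rfl)]
  refine ENNReal.add_ne_top.2 ⟨ne_top_of_le_ne_top (b := ∫⁻ s in Set.Ioc 0 (t₀ : ℝ), 1) (by simp)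
    (lintegral_mono fun s => prob_le_one), ne_top_of_le_ne_top hfin htail⟩

end IsBatchNetwork

/-! ### Limit in total variation and conclusion -/

theorem tendsto_setLIntegral_Ioi_atTop {f : ℝ → ℝ≥0∞} (hf : ∫⁻ s in Set.Ioi (0 : ℝ), f s ≠ ∞) :
    Tendsto (fun t : ℝ≥0 => ∫⁻ s in Set.Ioi (t : ℝ), f s) atTop (𝓝 0) := by
  have h := tendsto_measure_iInter_atTop (μ := volume.withDensity f)
    (s := fun t : ℝ≥0 => Set.Ioi (t : ℝ)) (fun _ => measurableSet_Ioi.nullMeasurableSet)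
    (fun _ _ h => Set.Ioi_subset_Ioi (NNReal.coe_le_coe.2 h))
    ⟨0, by rwa [withDensity_apply _ measurableSet_Ioi, NNReal.coe_zero]⟩
  have hempty : ⋂ t : ℝ≥0, Set.Ioi (t : ℝ) = ∅ := by
    rw [Set.eq_empty_iff_forall_notMem]
    intro x hx
    exact lt_irrefl _ ((Set.mem_iInter.1 hx x.toNNReal).trans_le (Real.le_coe_toNNReal x))
  rw [hempty, measure_empty] at h
  refine h.congr fun t => ?_
  exact withDensity_apply _ measurableSet_Ioi

/-- A family of probability measures on a countable space that is Cauchy in total variation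
converges to a probability measure. -/
theorem exists_pmf_tendsto_of_forall_le_add {E : Type*} [Countable E] [MeasurableSpace E]
    [MeasurableSingletonClass E] {p : ℝ≥0 → Measure E} [∀ t, IsProbabilityMeasure (p t)]
    {ε : ℝ≥0 → ℝ≥0∞} (hε : Tendsto ε atTop (𝓝 0))
    (h : ∀ t t', t ≤ t' → ∀ A, p t' A ≤ p t A + ε t) :
    ∃ π : PMF E, ∀ n, Tendsto (fun t => p t {n}) atTop (𝓝 (π n)) := by
  -- The upper bound at all later times gives limsup ≤ `p t A + ε t` for every `t`, hence limsup ≤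
  -- liminf.
  have hlim : ∀ A, ∃ a, Tendsto (fun t => p t A) atTop (𝓝 a) := by
    intro A
    refine ⟨liminf (fun t => p t A) atTop, tendsto_of_le_liminf_of_limsup_le le_rfl ?_⟩
    have h1 : ∀ t, limsup (fun t => p t A) atTop ≤ p t A + ε t := fun t =>
      limsup_le_of_le (h := (eventually_ge_atTop t).mono fun t' ht' => h t t' ht' A)
    set L := limsup (fun t => p t A) atTop
    have h2 : Tendsto (fun t => L - ε t) atTop (𝓝 (L - 0)) :=
      ENNReal.Tendsto.sub tendsto_const_nhds hε (Or.inr ENNReal.zero_ne_top)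
    rw [tsub_zero] at h2
    rw [← h2.liminf_eq]
    exact liminf_le_liminf (Eventually.of_forall fun t => tsub_le_iff_right.2 (h1 t))
  choose φ hφ using fun n => hlim {n}
  have hsum : ∀ F : Finset E, Tendsto (fun t => p t F) atTop (𝓝 (∑ n ∈ F, φ n)) := by
    intro F
    have h1 : (fun t => p t F) = fun t => ∑ n ∈ F, p t {n} := by
      funext t
      rw [sum_measure_singleton]
    rw [h1]
    exact tendsto_finsetSum F fun n _ => hφ n
  have hle : ∑' n, φ n ≤ 1 := ENNReal.summable.tsum_le_of_sum_le fun F =>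
    le_of_tendsto' (hsum F) fun t => prob_le_one
  -- Applied to complements, the upper bound becomes a lower bound.
  have h' : ∀ t t', t ≤ t' → ∀ A, p t A ≤ p t' A + ε t := by
    intro t t' ht A
    refine (ENNReal.add_le_add_iff_right (measure_ne_top (p t') Aᶜ)).1 ?_
    calc p t A + p t' Aᶜ ≤ p t A + (p t Aᶜ + ε t) := add_le_add le_rfl (h t t' ht Aᶜ)
      _ = p t' A + p t' Aᶜ + ε t := by
        rw [← add_assoc, prob_add_prob_compl MeasurableSet.of_discrete,
          prob_add_prob_compl MeasurableSet.of_discrete]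
      _ = p t' A + ε t + p t' Aᶜ := add_right_comm _ _ _
  -- No mass escapes: every finite set has `p t`-mass at most its limit mass plus `ε t`, and finite
  -- sets exhaust `p t`.
  have hge : 1 ≤ ∑' n, φ n := by
    have h1 : ∀ t, 1 ≤ ∑' n, φ n + ε t := by
      intro t
      rw [← measure_univ (μ := p t), ← Measure.tsum_indicator_apply_singleton (p t) Set.univ
        MeasurableSet.univ]
      simp only [Set.mem_univ, Set.indicator_of_mem]
      refine ENNReal.summable.tsum_le_of_sum_le fun F => ?_
      rw [sum_measure_singleton]
      have h2 : p t F ≤ ∑ n ∈ F, φ n + ε t := ge_of_tendsto ((hsum F).add_const (ε t))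
        ((eventually_ge_atTop t).mono fun t' ht' => h' t t' ht' F)
      exact h2.trans (add_le_add (ENNReal.sum_le_tsum F) le_rfl)
    have h2 : Tendsto (fun t => ∑' n, φ n + ε t) atTop (𝓝 (∑' n, φ n + 0)) :=
      tendsto_const_nhds.add hε
    rw [add_zero] at h2
    exact ge_of_tendsto' h2 h1
  exact ⟨⟨φ, le_antisymm hle hge ▸ ENNReal.summable.hasSum⟩, hφ⟩

theorem corollary4p3 {Ω : Type*} [MeasurableSpace Ω] (P : Measure Ω) [IsProbabilityMeasure P]
    (J : ℕ) (rate : ℝ) (batchLaw : Measure (Fin J → ℕ)) (q : Fin J → Fin J → ℝ≥0 → ℝ)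
    (D : BatchNetwork Ω J) (hD : IsBatchNetwork P rate batchLaw q D)
    (hQ : ExponentiallyBoundedTails q)
    (hS : Integrable (fun s : Fin J → ℕ => Real.log ((∑ j, (s j : ℝ)) + 1)) batchLaw) :
    D.Ergodic P := by
  -- `toNat` sends `⊤` to `0`; this is harmless since infinite queues have probability zero, so `f`
  -- merges states only on a null set.
  set f : (Fin J → ℕ∞) → Fin J → ℕ := fun n k => (n k).toNat with hf
  have hfm : Measurable f := measurable_of_countable f
  have := hD.isProbabilityMeasure_occupancyLaw
  have : ∀ t, IsProbabilityMeasure ((D.occupancyLaw P t).map f) := fun t =>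
    Measure.isProbabilityMeasure_map hfm.aemeasurable
  have htail := tendsto_setLIntegral_Ioi_atTop (hD.lintegral_map_batchOccupancy_ne_top hQ hS)
  have hε := ENNReal.Tendsto.const_mul (a := ENNReal.ofReal (rate * Real.exp rate)) htail
    (Or.inr ENNReal.ofReal_ne_top)
  rw [mul_zero] at hε
  obtain ⟨π, hπ⟩ := exists_pmf_tendsto_of_forall_le_add (p := fun t => (D.occupancyLaw P t).map f)
    hε fun t t' ht A => by
      rw [Measure.map_apply hfm MeasurableSet.of_discrete,
        Measure.map_apply hfm MeasurableSet.of_discrete]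
      refine (hD.occupancyLaw_le ht _).trans (add_le_add le_rfl (mul_le_mul_right ?_ _))
      exact lintegral_mono_set Set.Ioc_subset_Ioi_self
  refine ⟨π, fun n => (hπ n).congr fun t => ?_⟩
  rw [Measure.map_apply hfm MeasurableSet.of_discrete]
  have hset : P {ω | ∀ k, D.occupancy t k ω = (n k : ℕ∞)} =
      D.occupancyLaw P t {fun k => (n k : ℕ∞)} := by
    rw [BatchNetwork.occupancyLaw, Measure.map_apply (hD.measurable_occupancy_apply t)
      MeasurableSet.of_discrete]
    congr 1
    ext ω
    simp [funext_iff]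
  rw [hset]
  refine measure_congr ?_
  have hfin : ∀ᵐ m ∂(D.occupancyLaw P t), ¬ ∃ k, m k = ⊤ := by
    rw [ae_iff]
    simpa using hD.occupancyLaw_infinite t
  filter_upwards [hfin] with m hm
  refine propext ⟨fun h => ?_, fun h => ?_⟩
  · refine funext fun k => ?_
    have hk : (m k).toNat = n k := congrFun h k
    rw [← hk]
    exact (ENat.natCast_toNat fun h => hm ⟨k, h⟩).symm
  · obtain rfl : m = fun k => (n k : ℕ∞) := h
    exact funext fun k => ENat.toNat_natCast (n k)
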